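/- Conventions. Lattices are bounded. A space is spectral if it is sober and its compact open subsets form a base closed under finite intersections; a continuous map between spectral spaces is spectral if preimages of compact open sets are compact. The underlying order of a spectral space $X$ is $x\le y\iff y\in\overline{\{x\}}$. The patch $X_p$ of $X$ is the set $X$ with the topology generated by the open subsets and the complements of the compact open subsets of $X$, and $i\colon X_p\to X$ is the identity map. A spectral space $X$ is an Esakia space if for every open subset $A$ of $X_p$ the down-closure $\{x\mid \exists a\in A,\ x\le a\}$ is open in $X$. The lower Vietoris space $VY$ is the set of closed subsets of $Y$ with the topology generated by the sets $U^\Diamond=\{A\mid A\cap U\neq\varnothing\}$, $U\subseteq Y$ open. A relation $r$ from $X$ to $Y$ is a spectral distributor if $x\mapsto\{y\mid x\,r\,y\}$ is a spectral map $X\to VY$. Let $\mathsf{SpecDist}$ be the category of spectral spaces and spectral distributors, with relational composition and with the underlying orders as identities; $\mathsf{Spec}$ the category of spectral spaces and spectral maps; $\mathsf{EsaDist}$ and $\mathsf{Esa}$ their full subcategories of Esakia spaces. For a spectral map $f\colon X\to Y$ let $f_*\colon X\to Y$ be the spectral distributor $x\,f_*\,y\iff f(x)\le y$; for an Esakia space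 $X$ let $i^*\colon X\to X_p$ be the spectral distributor $x\,i^*\,z\iff x\le i(z)$. Let $\mathsf{DLat}$ be the category of distributive lattices and lattice homomorphisms (preserving $\bot,\top$), and $\mathsf{DLat}_{\bot,\vee}$ the category of distributive lattices and maps preserving finite suprema. A distributive lattice is a co-Heyting algebra if for all $a,b$ there is an element $a\setminus b$ with $a\setminus b\le d\iff a\le b\vee d$ for all $d$. Let $\mathsf{coHeyt}\subseteq\mathsf{DLat}$ and $\mathsf{coHeyt}_{\bot,\vee}\subseteq\mathsf{DLat}_{\bot,\vee}$ be the full subcategories of co-Heyting algebras. Theorem. The functor $\mathsf{SpecDist}\to\mathsf{DLat}_{\bot,\vee}^{\mathrm{op}}$ that sends a spectral space to its lattice of compact open subsets, and a spectral distributor $r\colon X\to Y$ to the map $B\mapsto\{x\mid\exists y\in B,\ x\,r\,y\}$, is an equivalence of categories. A spectral space is an Esakia space if and only if its lattice of compact open subsets is a co-Heyting algebra, and the equivalence restricts to an equivalence $$\mathsf{EsaDist}\simeq\mathsf{coHeyt}_{\bot,\vee}^{\mathrm{op}}.$$ On distributors of the form $f_*$, with $f$ a spectral map between Esakia spaces,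 it is given by the lattice homomorphism $B\mapsto f^{-1}(B)$, and this restriction to maps and lattice homomorphisms is an equivalence $$\mathsf{Esa}\simeq\mathsf{coHeyt}^{\mathrm{op}}.$$ Moreover, let $f\colon L_2\to L_1$ be a morphism of $\mathsf{coHeyt}$ and let $g\colon X_1\to X_2$ be a spectral map between Esakia spaces that corresponds to $f$ under this equivalence (up to isomorphisms of $L_k$ with the lattice of compact open subsets of $X_k$, $k=1,2$). Then the following are equivalent: 1. $f$ preserves the co-Heyting operation, that is, $f(a\setminus b)=f(a)\setminus f(b)$ for all $a,b\in L_2$; 2. $i_2^*\cdot g_*=g\cdot i_1^*$ as spectral distributors from $X_1$ to $(X_2)_p$, where on the right-hand side $g\colon (X_1)_p\to(X_2)_p$ is regarded as a relation; 3. for all $x\in X_1$ and $y\in X_2$ with $g(x)\le y$ there is some $x'\in X_1$ with $x\le x'$ and $g(x')=y$. -/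

import Mathlib

open CategoryTheory Opposite TopologicalSpace Topology

universe u

namespace EsakiaDuality

/-! ### Relations -/

section Relations

variable {X Y Z : Type u}

/-- The set of points that are related to some element of `B`. -/
def relPreimage (r : X → Y → Prop) (B : Set Y) : Set X := {x | ∃ y ∈ B, r x y}

/-- Relational composition (`r` first, then `s`). -/
def relComp (r : X → Y → Prop) (s : Y → Z → Prop) : X → Z → Prop :=
  fun x z => ∃ y, r x y ∧ s y z

theorem relPreimage_relComp (r : X → Y → Prop) (s : Y → Z → Prop) (B : Set Z) :
    relPreimage (relComp r s) B = relPreimage r (relPreimage s B) := by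
  ext x
  constructor
  · rintro ⟨z, hz, y, hr, hs⟩
    exact ⟨y, ⟨z, hz, hs⟩, hr⟩
  · rintro ⟨y, ⟨z, hz, hs⟩, hr⟩
    exact ⟨z, hz, y, hr, hs⟩

end Relations

/-! ### Underlying order, patch topology, Esakia spaces

The underlying order of a T0 space is `x ≤ y ↔ y ∈ closure {x}`, which in Mathlib is `x ⤳ y`. -/

section Topological

variable {X Y Z : Type u} [TopologicalSpace X] [TopologicalSpace Y] [TopologicalSpace Z]

/-- The down-closure `{x | ∃ a ∈ A, x ≤ a}` of a subset, for the underlying order. -/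
def downClosure (A : Set X) : Set X := {x | ∃ a ∈ A, x ⤳ a}

/-- A spectral space is an Esakia space if the down-closure of every patch-open subset is open.
The patch topology is Mathlib's constructible topology, see `patch_eq`. -/
def IsEsakia (X : Type u) [TopologicalSpace X] : Prop :=
  ∀ A : Set X, IsOpen[constructibleTopology X] A → IsOpen (downClosure A)

theorem le_patch [PrespectralSpace X] {U : Set X} (hU : IsOpen U) :
    IsOpen[constructibleTopology X] U := by
  obtain ⟨S, hS, rfl⟩ := PrespectralSpace.isTopologicalBasis.open_eq_sUnion hU
  exact @isOpen_sUnion X (constructibleTopology X) S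
    fun s hs => (hS hs).2.isOpen_constructibleTopology_of_isOpen (hS hs).1

/-- In a spectral space the constructible topology is generated by the open subsets and the
complements of the compact open subsets. -/
theorem patch_eq [PrespectralSpace X] : constructibleTopology X =
    generateFrom ({s | IsOpen s} ∪ {s | IsOpen sᶜ ∧ IsCompact sᶜ}) := by
  apply le_antisymm
  · refine le_generateFrom ?_
    rintro s (hs | hs)
    · exact le_patch hs
    · exact hs.2.isOpen_constructibleTopology_of_isClosed (isOpen_compl_iff.1 hs.1)
  · refine le_generateFrom ?_
    rintro s (hs | hs)
    · exact isOpen_generateFrom_of_mem (Or.inl hs.1)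
    · exact isOpen_generateFrom_of_mem (Or.inr ⟨hs.1.isOpen_compl, hs.2⟩)

/-- The identity `i : X_p → X` from the patch of `X`. -/
abbrev ofPatch : WithConstructibleTopology X → X := WithTopology.ofTopology

/-- The inverse of the bijection `ofPatch`. -/
abbrev toPatch : X → WithConstructibleTopology X := WithTopology.toTopology _

theorem isOpen_ofPatch_preimage {U : Set X} :
    IsOpen (ofPatch ⁻¹' U) ↔ IsOpen[constructibleTopology X] U :=
  WithConstructibleTopology.isOpen_iff

theorem continuous_ofPatch [PrespectralSpace X] : Continuous (ofPatch (X := X)) :=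
  continuous_def.2 fun _ hU => isOpen_ofPatch_preimage.2 (le_patch hU)

theorem isClopen_ofPatch {B : Set X} (ho : IsOpen B) (hc : IsCompact B) :
    IsClopen (ofPatch ⁻¹' B) := by
  refine ⟨isOpen_compl_iff.1 ?_, ?_⟩
  · rw [← Set.preimage_compl]
    exact isOpen_ofPatch_preimage.2
      (IsCompact.isOpen_constructibleTopology_of_isClosed (by rwa [compl_compl]) ho.isClosed_compl)
  · exact isOpen_ofPatch_preimage.2 (hc.isOpen_constructibleTopology_of_isOpen ho)

theorem isCompact_of_patch [SpectralSpace X] {A : Set X} (hA : IsClosed (ofPatch ⁻¹' A)) :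
    IsCompact A := by
  have h := hA.isCompact.image continuous_ofPatch
  rwa [Set.image_preimage_eq _ (WithTopology.ofTopology_surjective _)] at h

/-! ### The lower Vietoris space and spectral distributors -/

/-- The lower Vietoris space `V Y`: the set of closed subsets of `Y`, with the topology below. -/
@[ext]
structure LowerVietoris (Y : Type u) [TopologicalSpace Y] : Type u where
  carrier : Set Y
  isClosed : IsClosed carrier

/-- The set `U^◇ = {A | A ∩ U ≠ ∅}` of closed subsets. -/
def LowerVietoris.diamond (U : Set Y) : Set (LowerVietoris Y) :=
  {A | (A.carrier ∩ U).Nonempty}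

instance : TopologicalSpace (LowerVietoris Y) :=
  generateFrom {S | ∃ U : Set Y, IsOpen U ∧ S = LowerVietoris.diamond U}

/-- A relation is a spectral distributor if `x ↦ {y | r x y}` takes values in the closed subsets
and is a spectral map into the lower Vietoris space. -/
def IsSpectralDist (r : X → Y → Prop) : Prop :=
  ∃ φ : X → LowerVietoris Y, IsSpectralMap φ ∧ ∀ x, (φ x).carrier = {y | r x y}

theorem isOpen_diamond {U : Set Y} (hU : IsOpen U) : IsOpen (LowerVietoris.diamond U) :=
  isOpen_generateFrom_of_mem ⟨U, hU, rfl⟩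

theorem isCompact_diamond {B : Set Y} (hB : IsCompact B) :
    IsCompact (LowerVietoris.diamond B) := by
  refine isCompact_generateFrom rfl fun P hP hcov => ?_
  let c : Y → LowerVietoris Y := fun y => ⟨closure {y}, isClosed_closure⟩
  have hc : ∀ y (U : Set Y), IsOpen U → c y ∈ LowerVietoris.diamond U → y ∈ U := by
    rintro y U hU ⟨z, hz, hzU⟩
    exact (specializes_iff_mem_closure.2 hz).mem_open hU hzU
  let O : Set (Set Y) := {U | IsOpen U ∧ LowerVietoris.diamond U ∈ P}
  have hBO : B ⊆ ⋃ U ∈ O, id U := by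
    intro b hb
    have hb' : c b ∈ LowerVietoris.diamond B := ⟨b, subset_closure rfl, hb⟩
    obtain ⟨S, hS, hbS⟩ := hcov hb'
    obtain ⟨U, hU, rfl⟩ := hP hS
    exact Set.mem_biUnion (x := U) ⟨hU, hS⟩ (hc b U hU hbS)
  obtain ⟨T, hTO, hTf, hBT⟩ := hB.elim_finite_subcover_image (fun U hU => hU.1) hBO
  refine ⟨LowerVietoris.diamond '' T, ?_, hTf.image _, ?_⟩
  · rintro _ ⟨U, hU, rfl⟩
    exact (hTO hU).2
  · rintro A ⟨y, hyA, hyB⟩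
    obtain ⟨U, hU, hyU⟩ := Set.mem_iUnion₂.1 (hBT hyB)
    exact ⟨_, ⟨U, hU, rfl⟩, y, hyA, hyU⟩

theorem isSpectralDist_iff [SpectralSpace X] [PrespectralSpace Y] {r : X → Y → Prop} :
    IsSpectralDist r ↔ (∀ x, IsClosed {y | r x y}) ∧
      ∀ B : Set Y, IsOpen B → IsCompact B →
        IsOpen (relPreimage r B) ∧ IsCompact (relPreimage r B) := by
  constructor
  · rintro ⟨φ, hφ, h⟩
    refine ⟨fun x => h x ▸ (φ x).isClosed, fun B ho hc => ?_⟩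
    have : relPreimage r B = φ ⁻¹' LowerVietoris.diamond B := by
      ext x
      constructor
      · rintro ⟨y, hy, hr⟩
        exact ⟨y, by rw [h x]; exact hr, hy⟩
      · rintro ⟨y, hy, hyB⟩
        rw [h x] at hy
        exact ⟨y, hyB, hy⟩
    rw [this]
    exact ⟨(isOpen_diamond ho).preimage hφ.continuous,
      hφ.isCompact_preimage_of_isOpen (isOpen_diamond ho) (isCompact_diamond hc)⟩
  · rintro ⟨h₁, h₂⟩
    let φ : X → LowerVietoris Y := fun x => ⟨{y | r x y}, h₁ x⟩
    have key : ∀ B : Set Y, φ ⁻¹' LowerVietoris.diamond B = relPreimage r B := by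
      intro B
      ext x
      exact ⟨fun ⟨y, hy, hB⟩ => ⟨y, hB, hy⟩, fun ⟨y, hB, hy⟩ => ⟨y, hy, hB⟩⟩
    have hun : ∀ S : Set (Set Y), LowerVietoris.diamond (⋃₀ S)
        = ⋃ s ∈ S, LowerVietoris.diamond s := by
      intro S
      ext A
      simp only [LowerVietoris.diamond, Set.mem_iUnion]
      constructor
      · rintro ⟨y, hy, s, hs, hys⟩
        exact ⟨s, hs, y, hy, hys⟩
      · rintro ⟨s, hs, y, hy, hys⟩
        exact ⟨y, hy, s, hs, hys⟩
    refine ⟨φ, ⟨?_, ?_⟩, fun x => rfl⟩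
    · refine continuous_generateFrom_iff.2 ?_
      rintro _ ⟨U, hU, rfl⟩
      obtain ⟨S, hS, rfl⟩ := PrespectralSpace.isTopologicalBasis.open_eq_sUnion hU
      rw [hun, Set.preimage_iUnion₂]
      refine isOpen_biUnion fun s hs => ?_
      rw [key]
      exact (h₂ s (hS hs).1 (hS hs).2).1
    · intro W hWo hWc
      -- the finite intersections of sets `B^◇` with `B` compact open form a base
      let 𝒟 : Set (Set (LowerVietoris Y)) :=
        {S | ∃ B : Set Y, IsOpen B ∧ IsCompact B ∧ S = LowerVietoris.diamond B}
      have h𝒟 : (inferInstance : TopologicalSpace (LowerVietoris Y)) = generateFrom 𝒟 := by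
        apply le_antisymm
        · refine le_generateFrom ?_
          rintro _ ⟨B, hB, -, rfl⟩
          exact isOpen_diamond hB
        · refine le_generateFrom ?_
          rintro _ ⟨U, hU, rfl⟩
          obtain ⟨S, hS, rfl⟩ := PrespectralSpace.isTopologicalBasis.open_eq_sUnion hU
          rw [hun]
          refine @isOpen_biUnion _ _ (generateFrom 𝒟) _ _ fun s hs => ?_
          exact isOpen_generateFrom_of_mem ⟨s, (hS hs).1, (hS hs).2, rfl⟩
      have hbasis := isTopologicalBasis_of_subbasis h𝒟
      obtain ⟨F, hF, rfl⟩ := hbasis.open_eq_sUnion hWo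
      obtain ⟨G, hGF, hGf, hG⟩ := hWc.elim_finite_subcover_image (b := F) (c := id)
        (fun s hs => hbasis.isOpen (hF hs)) (by rw [Set.sUnion_eq_biUnion]; rfl)
      have : φ ⁻¹' ⋃₀ F = ⋃ s ∈ G, φ ⁻¹' s := by
        ext x
        constructor
        · intro hx
          simpa using hG hx
        · intro hx
          obtain ⟨s, hs, hxs⟩ := Set.mem_iUnion₂.1 hx
          exact ⟨s, hGF hs, hxs⟩
      rw [this]
      refine hGf.isCompact_biUnion fun s hs => ?_
      obtain ⟨E, ⟨hEf, hE⟩, rfl⟩ := hF (hGF hs)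
      change IsCompact (φ ⁻¹' ⋂₀ E)
      rw [Set.sInter_eq_biInter, Set.preimage_iInter₂, ← Set.sInter_image]
      refine QuasiSeparatedSpace.isCompact_sInter (hEf.image _) ?_ ?_
      · rintro _ ⟨D, hD, rfl⟩
        obtain ⟨B, ho, hc, rfl⟩ := hE hD
        simp only [key]
        exact Or.inl (h₂ B ho hc).1
      · rintro _ ⟨D, hD, rfl⟩
        obtain ⟨B, ho, hc, rfl⟩ := hE hD
        simp only [key]
        exact (h₂ B ho hc).2

theorem relPreimage_specializes {B : Set X} (hB : IsOpen B) :
    relPreimage (fun x y : X => x ⤳ y) B = B := by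
  ext x
  exact ⟨fun ⟨y, hy, h⟩ => h.mem_open hB hy, fun h => ⟨x, h, specializes_rfl⟩⟩

theorem isClosed_specializes (x : X) : IsClosed {y | x ⤳ y} := by
  have : {y | x ⤳ y} = closure {x} := Set.ext fun y => specializes_iff_mem_closure
  rw [this]
  exact isClosed_closure

/-- The underlying order is a spectral distributor. -/
theorem isSpectralDist_id [SpectralSpace X] : IsSpectralDist (fun x y : X => x ⤳ y) := by
  refine isSpectralDist_iff.2 ⟨isClosed_specializes, fun B ho hc => ?_⟩
  rw [relPreimage_specializes ho]
  exact ⟨ho, hc⟩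

theorem IsSpectralDist.comp [SpectralSpace X] [SpectralSpace Y] [SpectralSpace Z]
    {r : X → Y → Prop} {s : Y → Z → Prop} (hr : IsSpectralDist r) (hs : IsSpectralDist s) :
    IsSpectralDist (relComp r s) := by
  rw [isSpectralDist_iff] at *
  refine ⟨fun x => ?_, fun B ho hc => ?_⟩
  · rw [← isOpen_compl_iff, isOpen_iff_forall_mem_open]
    intro z hz
    by_contra hcon
    let I := {B : Set Z // IsOpen B ∧ IsCompact B ∧ z ∈ B}
    let t : I → Set (WithConstructibleTopology Y) :=
      fun B => ofPatch ⁻¹' ({y | r x y} ∩ relPreimage s B.1)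
    have hcl : ∀ B, IsClosed (t B) := by
      rintro ⟨B, ho, hc, -⟩
      exact ((hr.1 x).preimage continuous_ofPatch).inter
        (isClopen_ofPatch (hs.2 B ho hc).1 (hs.2 B ho hc).2).1
    have : Nonempty I := ⟨⟨Set.univ, isOpen_univ, isCompact_univ, trivial⟩⟩
    have hdir : Directed (· ⊇ ·) t := by
      rintro ⟨B, ho, hc, hz⟩ ⟨B', ho', hc', hz'⟩
      refine ⟨⟨B ∩ B', ho.inter ho', hc.inter_of_isOpen hc' ho ho', hz, hz'⟩, ?_, ?_⟩
      · rintro y ⟨h, w, hw, h'⟩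
        exact ⟨h, w, hw.1, h'⟩
      · rintro y ⟨h, w, hw, h'⟩
        exact ⟨h, w, hw.2, h'⟩
    have hne : ∀ B, (t B).Nonempty := by
      rintro ⟨B, ho, hc, hzB⟩
      by_contra hemp
      refine hcon ⟨B, ?_, ho, hzB⟩
      rintro w hw ⟨y, hxy, hyw⟩
      exact hemp ⟨toPatch y, hxy, w, hw, hyw⟩
    obtain ⟨y, hy⟩ := IsCompact.nonempty_iInter_of_directed_nonempty_isCompact_isClosed t hdir hne
      (fun B => (hcl B).isCompact) hcl
    rw [Set.mem_iInter] at hy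
    have hxy : r x (ofPatch y) := (hy (Classical.arbitrary I)).1
    refine hz ⟨ofPatch y, hxy, ?_⟩
    have : z ∈ closure {w | s (ofPatch y) w} := by
      rw [mem_closure_iff]
      intro U hU hzU
      obtain ⟨B, ⟨ho, hc⟩, hzB, hBU⟩ :=
        PrespectralSpace.isTopologicalBasis.exists_subset_of_mem_open hzU hU
      obtain ⟨-, w, hw, h⟩ := hy ⟨B, ho, hc, hzB⟩
      exact ⟨w, hBU hw, h⟩
    rwa [(hs.1 _).closure_eq] at this
  · rw [relPreimage_relComp]
    exact hr.2 _ (hs.2 B ho hc).1 (hs.2 B ho hc).2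

theorem relPreimage_star {X : Type u} {f : X → Y} {B : Set Y} (hB : IsOpen B) :
    relPreimage (fun x y => f x ⤳ y) B = f ⁻¹' B := by
  ext x
  exact ⟨fun ⟨y, hy, h⟩ => h.mem_open hB hy, fun h => ⟨f x, h, specializes_rfl⟩⟩

/-- For a spectral map `f`, the relation `f_*`, given by `x f_* y ↔ f x ≤ y`, is a spectral
distributor. -/
theorem isSpectralDist_star [SpectralSpace X] [PrespectralSpace Y] {f : X → Y}
    (hf : IsSpectralMap f) : IsSpectralDist (fun x y => f x ⤳ y) := by
  refine isSpectralDist_iff.2 ⟨fun x => isClosed_specializes (f x), fun B ho hc => ?_⟩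
  rw [relPreimage_star ho]
  exact ⟨ho.preimage hf.continuous, hf.isCompact_preimage_of_isOpen ho hc⟩

theorem isCompact_downClosure {A : Set X} (hA : IsCompact A) : IsCompact (downClosure A) := by
  refine isCompact_of_finite_subcover fun U hU hcov => ?_
  obtain ⟨t, ht⟩ := hA.elim_finite_subcover U hU
    (Set.Subset.trans (fun a ha => (⟨a, ha, specializes_rfl⟩ : a ∈ downClosure A)) hcov)
  refine ⟨t, ?_⟩
  rintro x ⟨a, ha, hxa⟩
  obtain ⟨i, hi, hai⟩ := Set.mem_iUnion₂.1 (ht ha)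
  exact Set.mem_iUnion₂.2 ⟨i, hi, hxa.mem_open (hU i) hai⟩

instance t2Space_patch [SpectralSpace X] : T2Space (WithConstructibleTopology X) := by
  refine ⟨fun x y hxy => ?_⟩
  have hne : ofPatch x ≠ ofPatch y := fun h => hxy (WithTopology.ofTopology_injective _ h)
  have sep : ∀ a b : WithConstructibleTopology X, ¬ ofPatch a ⤳ ofPatch b →
      ∃ u v : Set (WithConstructibleTopology X),
        IsOpen u ∧ IsOpen v ∧ a ∈ u ∧ b ∈ v ∧ Disjoint u v := by
    intro a b hab
    rw [specializes_iff_forall_open] at hab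
    push Not at hab
    obtain ⟨U, hU, hb, ha⟩ := hab
    obtain ⟨B, ⟨ho, hc⟩, hbB, hBU⟩ :=
      PrespectralSpace.isTopologicalBasis.exists_subset_of_mem_open hb hU
    have hcl := isClopen_ofPatch ho hc
    exact ⟨(ofPatch ⁻¹' B)ᶜ, ofPatch ⁻¹' B, hcl.1.isOpen_compl, hcl.2,
      fun h => ha (hBU h), hbB, disjoint_compl_left⟩
  by_cases h : ofPatch x ⤳ ofPatch y
  · have h' : ¬ ofPatch y ⤳ ofPatch x := fun h' => hne (h.antisymm h').eq
    obtain ⟨u, v, hu, hv, hyu, hxv, hd⟩ := sep y x h'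
    exact ⟨v, u, hv, hu, hxv, hyu, hd.symm⟩
  · exact sep x y h

/-- The patch of a spectral space is spectral (indeed a Stone space). -/
instance spectralSpace_patch [SpectralSpace X] : SpectralSpace (WithConstructibleTopology X) := by
  have hpre : PrespectralSpace (WithConstructibleTopology X) := by
    let 𝒟 : Set (Set (WithConstructibleTopology X)) :=
      {s | ∃ t ∈ constructibleTopologySubbasis X, s = ofPatch ⁻¹' t}
    have h𝒟 : (inferInstance : TopologicalSpace (WithConstructibleTopology X))
        = generateFrom 𝒟 := by
      apply TopologicalSpace.ext_iff.2
      intro s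
      constructor
      · intro hs
        have hs' : IsOpen[constructibleTopology X] (toPatch ⁻¹' s) :=
          WithConstructibleTopology.isOpen_iff.1 hs
        have hle : generateFrom 𝒟 ≤ (constructibleTopology X).induced ofPatch := by
          rw [constructibleTopology, induced_generateFrom_eq]
          refine le_generateFrom ?_
          rintro _ ⟨t, ht, rfl⟩
          exact isOpen_generateFrom_of_mem ⟨t, ht, rfl⟩
        exact hle s ⟨_, hs', rfl⟩
      · intro hs
        have hle : (inferInstance : TopologicalSpace (WithConstructibleTopology X))
            ≤ generateFrom 𝒟 := by
          refine le_generateFrom ?_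
          rintro _ ⟨t, ht, rfl⟩
          exact isOpen_ofPatch_preimage.2 (isOpen_generateFrom_of_mem ht)
        exact hle s hs
    refine .of_isTopologicalBasis (isTopologicalBasis_of_subbasis h𝒟) ?_
    rintro _ ⟨F, ⟨hf, hF⟩, rfl⟩
    refine IsClosed.isCompact (isClosed_sInter fun s hs => ?_)
    obtain ⟨t, ht, rfl⟩ := hF hs
    rcases ht with ht | ht
    · exact (isClopen_ofPatch ht.1 ht.2).1
    · have := (isClopen_ofPatch ht.1.isOpen_compl ht.2).2
      rw [Set.preimage_compl] at this
      exact isOpen_compl_iff.1 this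
  exact { hpre with }

/-- A spectral map, regarded as a map between the patches. -/
def patchFun (f : X → Y) : WithConstructibleTopology X → WithConstructibleTopology Y :=
  fun x => toPatch (f (ofPatch x))

theorem isSpectralMap_patchFun [SpectralSpace X] [SpectralSpace Y] {f : X → Y}
    (hf : IsSpectralMap f) : IsSpectralMap (patchFun f) := by
  have hcont : Continuous (patchFun f) := by
    refine continuous_def.2 fun s hs => ?_
    have hs' : IsOpen[constructibleTopology Y] (toPatch ⁻¹' s) :=
      WithConstructibleTopology.isOpen_iff.1 hs
    have hle : constructibleTopology X ≤ (constructibleTopology Y).induced f := by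
      rw [constructibleTopology.eq_1 Y, induced_generateFrom_eq]
      refine le_generateFrom ?_
      rintro _ ⟨t, ht | ht, rfl⟩
      · exact (hf.isCompact_preimage_of_isOpen ht.1 ht.2).isOpen_constructibleTopology_of_isOpen
          (ht.1.preimage hf.continuous)
      · exact IsCompact.isOpen_constructibleTopology_of_isClosed
          (hf.isCompact_preimage_of_isOpen ht.1.isOpen_compl ht.2) (ht.1.preimage hf.continuous)
    exact isOpen_ofPatch_preimage.2 (hle _ ⟨_, hs', rfl⟩)
  exact ⟨hcont, fun s _ hs => (hs.isClosed.preimage hcont).isCompact⟩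

/-- For an Esakia space, the relation `i^*`, given by `x i^* z ↔ x ≤ i z`, is a spectral
distributor from `X` to the patch of `X`. -/
theorem isSpectralDist_upperStar [SpectralSpace X] (hX : IsEsakia X) :
    IsSpectralDist (fun (x : X) (z : WithConstructibleTopology X) => x ⤳ ofPatch z) := by
  refine isSpectralDist_iff.2
    ⟨fun x => (isClosed_specializes x).preimage continuous_ofPatch, fun B ho hc => ?_⟩
  have hB : relPreimage (fun (x : X) (z : WithConstructibleTopology X) => x ⤳ ofPatch z) B
      = downClosure (toPatch ⁻¹' B) := by
    ext x
    exact ⟨fun ⟨z, hz, h⟩ => ⟨ofPatch z, hz, h⟩, fun ⟨a, ha, h⟩ => ⟨toPatch a, ha, h⟩⟩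
  rw [hB]
  exact ⟨hX _ (WithConstructibleTopology.isOpen_iff.1 ho),
    isCompact_downClosure (isCompact_of_patch (A := toPatch ⁻¹' B) hc.isClosed)⟩

end Topological

/-! ### Categories of spaces -/

/-- The category `Spec` of spectral spaces and spectral maps. -/
structure Spec : Type (u + 1) where
  carrier : Type u
  [top : TopologicalSpace carrier]
  [spectral : SpectralSpace carrier]

attribute [instance] Spec.top Spec.spectral

/-- Morphisms of `Spec`. -/
@[ext]
structure Spec.Hom (X Y : Spec.{u}) : Type u where
  map : SpectralMap X.carrier Y.carrier

instance : Category Spec.{u} where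
  Hom := Spec.Hom
  id X := ⟨SpectralMap.id X.carrier⟩
  comp f g := ⟨g.map.comp f.map⟩

/-- The category `SpecDist` of spectral spaces and spectral distributors. -/
structure SpecDist : Type (u + 1) where
  carrier : Type u
  [top : TopologicalSpace carrier]
  [spectral : SpectralSpace carrier]

attribute [instance] SpecDist.top SpecDist.spectral

/-- Morphisms of `SpecDist`. -/
@[ext]
structure SpecDist.Hom (X Y : SpecDist.{u}) : Type u where
  rel : X.carrier → Y.carrier → Prop
  isSpectralDist : IsSpectralDist rel

/-- Composition is relational composition; the identity is the underlying order. -/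
instance : Category SpecDist.{u} where
  Hom := SpecDist.Hom
  id X := ⟨fun x y => x ⤳ y, isSpectralDist_id⟩
  comp r s := ⟨relComp r.rel s.rel, r.isSpectralDist.comp s.isSpectralDist⟩
  id_comp {X Y} r := by
    apply SpecDist.Hom.ext
    funext x y
    refine propext ⟨?_, fun h => ⟨x, specializes_rfl, h⟩⟩
    rintro ⟨x', hx, h⟩
    obtain ⟨φ, hφ, hr⟩ := r.isSpectralDist
    by_contra hy
    have ho : IsOpen {y | r.rel x y}ᶜ := by
      rw [← hr x]
      exact (φ x).isClosed.isOpen_compl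
    have hx' : φ x' ∈ LowerVietoris.diamond {y | r.rel x y}ᶜ :=
      ⟨y, by rw [hr x']; exact h, hy⟩
    have := hx.mem_open ((isOpen_diamond ho).preimage hφ.continuous) hx'
    obtain ⟨z, hz, hz'⟩ := this
    rw [hr x] at hz
    exact hz' hz
  comp_id {X Y} r := by
    apply SpecDist.Hom.ext
    funext x y
    refine propext ⟨?_, fun h => ⟨y, h, specializes_rfl⟩⟩
    rintro ⟨y', h, hy⟩
    exact hy.mem_closed ((isSpectralDist_iff.1 r.isSpectralDist).1 x) h
  assoc {W X Y Z} r s t := by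
    apply SpecDist.Hom.ext
    funext w z
    refine propext ⟨?_, ?_⟩
    · rintro ⟨y, ⟨x, h₁, h₂⟩, h₃⟩
      exact ⟨x, h₁, y, h₂, h₃⟩
    · rintro ⟨x, h₁, y, h₂, h₃⟩
      exact ⟨y, ⟨x, h₁, h₂⟩, h₃⟩

/-- The functor `(-)_* : Spec ⥤ SpecDist`, the identity on objects, where `x f_* y ↔ f x ≤ y`. -/
def lowerStar : Spec.{u} ⥤ SpecDist.{u} where
  obj X := ⟨X.carrier⟩
  map f := ⟨fun x y => f.map x ⤳ y, isSpectralDist_star f.map.spectral'⟩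
  map_id _ := rfl
  map_comp {X Y Z} f g := by
    apply SpecDist.Hom.ext
    funext x z
    refine propext ⟨fun h => ⟨f.map x, specializes_rfl, h⟩, ?_⟩
    rintro ⟨y, h, h'⟩
    exact (h.map g.map.spectral'.continuous).trans h'

/-- The full subcategory `EsaDist` of `SpecDist` defined by the Esakia spaces. -/
abbrev EsaDist : Type (u + 1) :=
  ObjectProperty.FullSubcategory fun X : SpecDist.{u} => IsEsakia X.carrier

/-- The full subcategory `Esa` of `Spec` defined by the Esakia spaces. -/
abbrev Esa : Type (u + 1) :=
  ObjectProperty.FullSubcategory fun X : Spec.{u} => IsEsakia X.carrier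

/-- The restriction `Esa ⥤ EsaDist` of the functor `(-)_*`. -/
def esaStar : Esa.{u} ⥤ EsaDist.{u} :=
  ObjectProperty.lift _ (ObjectProperty.ι _ ⋙ lowerStar) fun X => X.property

/-- The patch `X_p` of a spectral space `X`. -/
def Spec.patch (X : Spec.{u}) : Spec.{u} := ⟨WithConstructibleTopology X.carrier⟩

/-- The map `g`, regarded as a map `X_p ⟶ Y_p`. -/
def Spec.patchMap {X Y : Spec.{u}} (g : X ⟶ Y) : X.patch ⟶ Y.patch :=
  ⟨⟨patchFun g.map, isSpectralMap_patchFun g.map.spectral'⟩⟩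

/-- The spectral distributor `i^*` from an Esakia space `X` to its patch `X_p`, where
`x i^* z ↔ x ≤ i z` for the identity `i : X_p → X`. -/
def iUpperStar (X : Esa.{u}) : lowerStar.obj X.obj ⟶ lowerStar.obj X.obj.patch :=
  ⟨fun (x : X.obj.carrier) (z : WithConstructibleTopology X.obj.carrier) => x ⤳ ofPatch z,
    isSpectralDist_upperStar X.property⟩

/-! ### Categories of lattices -/

/-- The category `DLat_{⊥,∨}` of (bounded) distributive lattices and maps preserving finite
suprema. The category `DLat` is Mathlib's `BddDistLat`. -/
structure DLatSup : Type (u + 1) where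
  toDLat : BddDistLat.{u}

/-- Morphisms of `DLat_{⊥,∨}`: maps preserving `⊥` and binary suprema. -/
@[ext]
structure DLatSup.Hom (L M : DLatSup.{u}) : Type u where
  hom : SupBotHom L.toDLat M.toDLat

instance : Category DLatSup.{u} where
  Hom := DLatSup.Hom
  id L := ⟨SupBotHom.id L.toDLat⟩
  comp f g := ⟨g.hom.comp f.hom⟩

/-- The inclusion functor `DLat ⥤ DLat_{⊥,∨}`. -/
def forgetInf : BddDistLat.{u} ⥤ DLatSup.{u} where
  obj L := ⟨L⟩
  map f := ⟨(f.hom : SupBotHom _ _)⟩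

/-- The lattice `α` is a co-Heyting algebra: for all `a` and `b` there is a least `d` with
`a ≤ b ⊔ d`, expressed as an adjunction. -/
def IsCoHeyting (α : Type u) [Lattice α] : Prop :=
  ∀ a b : α, ∃ c : α, ∀ d : α, c ≤ d ↔ a ≤ b ⊔ d

/-- The full subcategory `coHeyt_{⊥,∨}` of `DLat_{⊥,∨}` defined by the co-Heyting algebras. -/
abbrev CoHeytSup : Type (u + 1) :=
  ObjectProperty.FullSubcategory fun L : DLatSup.{u} => IsCoHeyting L.toDLat

/-- The full subcategory `coHeyt` of `DLat` defined by the co-Heyting algebras. -/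
abbrev CoHeyt : Type (u + 1) :=
  ObjectProperty.FullSubcategory fun L : BddDistLat.{u} => IsCoHeyting L

/-- The inclusion functor `coHeyt ⥤ coHeyt_{⊥,∨}`. -/
def coHeytForgetInf : CoHeyt.{u} ⥤ CoHeytSup.{u} :=
  ObjectProperty.lift _ (ObjectProperty.ι _ ⋙ forgetInf) fun L => L.property

/-- The (unique) co-Heyting operation of an object of `coHeyt`; `a \ b` is the least `d` with
`a ≤ b ⊔ d`. -/
noncomputable instance (L : CoHeyt.{u}) : CoheytingAlgebra L.obj where
  sdiff a b := (L.property a b).choose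
  hnot a := (L.property ⊤ a).choose
  sdiff_le_iff a b := (L.property a b).choose_spec
  top_sdiff _ := rfl

/-- A lattice homomorphism between co-Heyting algebras preserves the co-Heyting operation. -/
def PreservesCoHeyting {L M : CoHeyt.{u}} (f : L ⟶ M) : Prop :=
  ∀ a b : L.obj, f.hom (a \ b) = f.hom a \ f.hom b

/-! ### The lattice of compact open subsets -/

instance (X : Type u) [TopologicalSpace X] [QuasiSeparatedSpace X] :
    DistribLattice (CompactOpens X) where
  __ := (inferInstance : SemilatticeSup (CompactOpens X))
  __ := (inferInstance : SemilatticeInf (CompactOpens X))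
  le_sup_inf a b c := by
    intro x hx
    rcases hx with ⟨ha | hb, ha' | hc⟩
    · exact Or.inl ha
    · exact Or.inl ha
    · exact Or.inl ha'
    · exact Or.inr ⟨hb, hc⟩

/-- The map `B ↦ {x | ∃ y ∈ B, r x y}` on compact open subsets, for a spectral distributor `r`. -/
def SpecDist.Hom.preimage {X Y : SpecDist.{u}} (r : SpecDist.Hom X Y) :
    SupBotHom (CompactOpens Y.carrier) (CompactOpens X.carrier) where
  toFun B := ⟨⟨relPreimage r.rel B,
    ((isSpectralDist_iff.1 r.isSpectralDist).2 B B.isOpen B.isCompact).2⟩,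
    ((isSpectralDist_iff.1 r.isSpectralDist).2 B B.isOpen B.isCompact).1⟩
  map_sup' A B := by
    apply CompactOpens.ext
    ext x
    constructor
    · rintro ⟨y, hA | hB, h⟩
      · exact Or.inl ⟨y, hA, h⟩
      · exact Or.inr ⟨y, hB, h⟩
    · rintro (⟨y, hy, h⟩ | ⟨y, hy, h⟩)
      · exact ⟨y, Or.inl hy, h⟩
      · exact ⟨y, Or.inr hy, h⟩
  map_bot' := by
    apply CompactOpens.ext
    ext x
    exact ⟨fun ⟨y, hy, _⟩ => hy.elim, fun h => h.elim⟩

/-- The contravariant functor `SpecDist ⥤ DLat_{⊥,∨}` sending a spectral space to its lattice of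
compact open subsets and `r` to `B ↦ {x | ∃ y ∈ B, r x y}`. -/
def compactOpensDist : SpecDist.{u}ᵒᵖ ⥤ DLatSup.{u} where
  obj X := ⟨BddDistLat.of (CompactOpens X.unop.carrier)⟩
  map r := ⟨r.unop.preimage⟩
  map_id X := by
    apply DLatSup.Hom.ext
    apply SupBotHom.ext
    intro B
    exact CompactOpens.ext (relPreimage_specializes B.isOpen)
  map_comp {X Y Z} r s := by
    apply DLatSup.Hom.ext
    apply SupBotHom.ext
    intro B
    exact CompactOpens.ext (relPreimage_relComp s.unop.rel r.unop.rel B)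

theorem isCoHeyting_compactOpens {X : Type u} [TopologicalSpace X] [SpectralSpace X]
    (hX : IsEsakia X) : IsCoHeyting (CompactOpens X) := by
  intro A B
  have hcl : IsClopen (ofPatch ⁻¹' ((A : Set X) \ B)) :=
    (isClopen_ofPatch A.isOpen A.isCompact).diff (isClopen_ofPatch B.isOpen B.isCompact)
  refine ⟨⟨⟨downClosure ((A : Set X) \ B), isCompact_downClosure (isCompact_of_patch hcl.1)⟩,
    hX _ (isOpen_ofPatch_preimage.1 hcl.2)⟩, fun D => ⟨fun h x hx => ?_, ?_⟩⟩
  · by_cases hB : x ∈ B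
    · exact Or.inl hB
    · exact Or.inr (h ⟨x, ⟨hx, hB⟩, specializes_rfl⟩)
  · rintro h x ⟨a, ⟨haA, haB⟩, hxa⟩
    exact hxa.mem_open D.isOpen ((h haA).resolve_left haB)

/-- The restriction of `compactOpensDist` to Esakia spaces and co-Heyting algebras. -/
def compactOpensEsaDist : EsaDist.{u}ᵒᵖ ⥤ CoHeytSup.{u} :=
  ObjectProperty.lift _ ((ObjectProperty.ι _).op ⋙ compactOpensDist)
    fun X => isCoHeyting_compactOpens X.unop.property

/-- The contravariant functor `Esa ⥤ coHeyt` sending an Esakia space to its lattice of compact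
open subsets and a spectral map `f` to `B ↦ f⁻¹(B)`. -/
def compactOpensEsa : Esa.{u}ᵒᵖ ⥤ CoHeyt.{u} where
  obj X := ⟨BddDistLat.of (CompactOpens X.unop.obj.carrier),
    isCoHeyting_compactOpens X.unop.property⟩
  map f := ObjectProperty.homMk (BddDistLat.ofHom
    { toFun := fun B => ⟨⟨f.unop.hom.map ⁻¹' B,
        f.unop.hom.map.spectral'.isCompact_preimage_of_isOpen B.isOpen B.isCompact⟩,
        B.isOpen.preimage f.unop.hom.map.spectral'.continuous⟩
      map_sup' := fun _ _ => rfl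
      map_inf' := fun _ _ => rfl
      map_top' := rfl
      map_bot' := rfl })

end EsakiaDuality

open EsakiaDuality

/-!
# Esakia duality for spectral distributors

A distributor `r : X → Y` has closed values, and a closed set is determined by the compact open
sets that it meets, so `r` is determined by its preimage map on compact open sets
(`rel_iff_forall_compactOpens`). Conversely a map `h` preserving finite suprema gives the relation
"`x ∈ h B` for all `B ∋ y`" (`relOfHom`). By compactness of `B`, applied to the family of those
`C` with `x ∉ h C`, its preimage map is `h` again (`relPreimage_relOfHom`). If `h` preserves
finite infima as well, the values of this relation are irreducible closed sets, and sobriety turns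
it into a spectral map (`exists_spectralMap_preimage_eq`). Every bounded distributive lattice is a
lattice of compact open sets by Stone's representation on its prime filters
(`PrimeFilter.orderIsoCompactOpens`).

Differences `A \ B` of compact open sets form a base of the patch topology, and a co-Heyting
difference of `A` and `B` can only be the down-closure of the set `A \ B`
(`coe_eq_downClosure_of_sdiff_adjoint`). Hence Esakia spaces correspond to co-Heyting algebras,
and a spectral map `g` preserves the co-Heyting operation if and only if taking preimages along
`g` commutes with down-closures of such differences. Patch-compactness of `closure {x}`, applied
to the filtered family of all `A \ B` containing a given `y`, identifies this with the back
condition (`preimage_downClosure_diff_iff`). The equation of distributors unfolds to the same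
condition because the patch is Hausdorff (`lowerStar_map_comp_iUpperStar_eq_iff`).
-/

namespace EsakiaDuality

/-! ### The space of prime filters of a distributive lattice -/

/-- A prime filter of a bounded lattice `L`: a set of elements containing `⊤`, avoiding `⊥`, and
compatible with `⊓` and `⊔` in the way membership of a fixed point in a set is compatible with
`∩` and `∪`. -/
@[ext]
structure PrimeFilter (L : Type u) [Lattice L] [BoundedOrder L] : Type u where
  carrier : Set L
  top_mem : ⊤ ∈ carrier
  bot_notMem : ⊥ ∉ carrier
  inf_mem_iff : ∀ {a b : L}, a ⊓ b ∈ carrier ↔ a ∈ carrier ∧ b ∈ carrier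
  sup_mem_iff : ∀ {a b : L}, a ⊔ b ∈ carrier ↔ a ∈ carrier ∨ b ∈ carrier

namespace PrimeFilter

section Lattice

variable {L : Type u} [Lattice L] [BoundedOrder L]

/-- The set of prime filters containing `a`. -/
def basicOpen (a : L) : Set (PrimeFilter L) := {p | a ∈ p.carrier}

/-- The topology generated by the sets `basicOpen a`. -/
instance : TopologicalSpace (PrimeFilter L) := generateFrom (Set.range basicOpen)

theorem isOpen_basicOpen (a : L) : IsOpen (basicOpen a) :=
  isOpen_generateFrom_of_mem ⟨a, rfl⟩

theorem basicOpen_top : basicOpen (⊤ : L) = Set.univ :=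
  Set.eq_univ_of_forall fun p => p.top_mem

theorem basicOpen_bot : basicOpen (⊥ : L) = ∅ :=
  Set.eq_empty_of_forall_notMem fun p => p.bot_notMem

theorem basicOpen_inf (a b : L) : basicOpen (a ⊓ b) = basicOpen a ∩ basicOpen b :=
  Set.ext fun p => p.inf_mem_iff

theorem basicOpen_sup (a b : L) : basicOpen (a ⊔ b) = basicOpen a ∪ basicOpen b :=
  Set.ext fun p => p.sup_mem_iff

theorem basicOpen_mono {a b : L} (h : a ≤ b) : basicOpen a ⊆ basicOpen b := by
  rw [← inf_eq_left.2 h, basicOpen_inf]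
  exact Set.inter_subset_right

theorem isTopologicalBasis_basicOpen :
    IsTopologicalBasis (Set.range (basicOpen : L → Set (PrimeFilter L))) where
  exists_subset_inter := by
    rintro _ ⟨a, rfl⟩ _ ⟨b, rfl⟩ p hp
    exact ⟨_, ⟨a ⊓ b, rfl⟩, by rwa [basicOpen_inf], (basicOpen_inf a b).subset⟩
  sUnion_eq := Set.eq_univ_of_forall fun p => ⟨_, ⟨⊤, rfl⟩, p.top_mem⟩
  eq_generateFrom := rfl

instance : T0Space (PrimeFilter L) := by
  refine ⟨fun p q h => ?_⟩
  ext a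
  exact h.mem_open_iff (isOpen_basicOpen a)

/-- The generic point of an irreducible closed set `S` consists of those `a` for which `basicOpen a`
meets `S`. -/
instance : QuasiSober (PrimeFilter L) := by
  refine ⟨fun {S} hS hcl => ?_⟩
  let p : PrimeFilter L :=
    { carrier := {a | (S ∩ basicOpen a).Nonempty}
      top_mem := by simpa [basicOpen_top] using hS.nonempty
      bot_notMem := by simp [basicOpen_bot]
      inf_mem_iff := by
        intro a b
        simp only [Set.mem_ofPred_eq, basicOpen_inf]
        refine ⟨fun h => ⟨h.mono (by grind), h.mono (by grind)⟩, fun ⟨ha, hb⟩ => ?_⟩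
        exact hS.2 _ _ (isOpen_basicOpen a) (isOpen_basicOpen b) ha hb
      sup_mem_iff := by
        intro a b
        simp only [Set.mem_ofPred_eq, basicOpen_sup, Set.inter_union_distrib_left,
          Set.union_nonempty] }
  refine ⟨p, isGenericPoint_iff_specializes.2 fun q => ⟨fun h => ?_, fun h => ?_⟩⟩
  · by_contra hq
    obtain ⟨_, ⟨a, rfl⟩, hqa, ha⟩ :=
      isTopologicalBasis_basicOpen.exists_subset_of_mem_open hq hcl.isOpen_compl
    obtain ⟨s, hs, hsa⟩ := h.mem_open (isOpen_basicOpen a) hqa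
    exact ha hsa hs
  · refine specializes_iff_forall_open.2 fun U hU hqU => ?_
    obtain ⟨_, ⟨a, rfl⟩, hqa, ha⟩ :=
      isTopologicalBasis_basicOpen.exists_subset_of_mem_open hqU hU
    exact ha ⟨q, h, hqa⟩

end Lattice

variable {L : Type u} [DistribLattice L] [BoundedOrder L]

/-- The prime filter theorem: the complement of a prime ideal separating `a` from `I` is a prime
filter. -/
theorem exists_mem_and_disjoint {I : Order.Ideal L} {a : L} (ha : a ∉ I) :
    ∃ p : PrimeFilter L, a ∈ p.carrier ∧ ∀ b ∈ I, b ∉ p.carrier := by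
  have hd : Disjoint (Order.PFilter.principal a : Set L) (I : Set L) := by
    refine Set.disjoint_left.2 fun b hb hbI => ha (I.lower ?_ hbI)
    simpa using hb
  obtain ⟨J, hJ, hIJ, hJd⟩ := DistribLattice.prime_ideal_of_disjoint_filter_ideal hd
  have hT := hJ.toIsProper.top_notMem
  refine ⟨⟨(J : Set L)ᶜ, hT, fun h => h J.bot_mem, ?_, ?_⟩, ?_, fun b hb h => h (hIJ hb)⟩
  · intro b c
    refine ⟨fun h => ⟨fun hb => h (J.lower inf_le_left hb), fun hc => h (J.lower inf_le_right hc)⟩,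
      fun ⟨hb, hc⟩ h => (hJ.mem_or_mem h).elim hb hc⟩
  · intro b c
    simp only [Set.mem_compl_iff, SetLike.mem_coe, Order.Ideal.sup_mem_iff]
    tauto
  · exact fun h => Set.disjoint_left.1 hJd (by simp) h

theorem basicOpen_subset_iff {a b : L} : basicOpen a ⊆ basicOpen b ↔ a ≤ b := by
  refine ⟨fun h => ?_, basicOpen_mono⟩
  by_contra hab
  obtain ⟨p, hpa, hp⟩ := exists_mem_and_disjoint (I := Order.Ideal.principal b) (a := a) (by simpa)
  exact hp b (by simp) (h hpa)

theorem isCompact_basicOpen (a : L) : IsCompact (basicOpen a) := by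
  refine isCompact_generateFrom rfl fun P hP hcov => ?_
  -- the ideal of the elements whose basic open set is covered by a finite part of `P`
  let I : Order.Ideal L := Order.IsIdeal.toIdeal
    (I := {x : L | ∃ Q ⊆ P, Q.Finite ∧ basicOpen x ⊆ ⋃₀ Q}) <| by
    refine ⟨?_, ⟨⊥, ∅, by simp [basicOpen_bot]⟩, ?_⟩
    · rintro x y hyx ⟨Q, hQP, hQ, hx⟩
      exact ⟨Q, hQP, hQ, (basicOpen_mono hyx).trans hx⟩
    · rintro x ⟨Q, hQP, hQ, hx⟩ y ⟨R, hRP, hR, hy⟩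
      refine ⟨x ⊔ y, ⟨Q ∪ R, Set.union_subset hQP hRP, hQ.union hR, ?_⟩, le_sup_left, le_sup_right⟩
      rw [basicOpen_sup, Set.sUnion_union]
      exact Set.union_subset_union hx hy
  suffices h : a ∈ I from h
  by_contra ha
  obtain ⟨p, hpa, hp⟩ := exists_mem_and_disjoint ha
  obtain ⟨_, hS, hpS⟩ := hcov hpa
  obtain ⟨s, rfl⟩ := hP hS
  exact hp s ⟨{basicOpen s}, by simpa, Set.finite_singleton _, by simp⟩ hpS

instance : SpectralSpace (PrimeFilter L) where
  isCompact_univ := basicOpen_top (L := L) ▸ isCompact_basicOpen ⊤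
  toPrespectralSpace := .of_isTopologicalBasis' isTopologicalBasis_basicOpen isCompact_basicOpen
  toQuasiSeparatedSpace := .of_isTopologicalBasis isTopologicalBasis_basicOpen fun a b => by
    rw [← basicOpen_inf]
    exact isCompact_basicOpen _

theorem exists_eq_basicOpen {U : Set (PrimeFilter L)} (ho : IsOpen U) (hc : IsCompact U) :
    ∃ a, basicOpen a = U := by
  let ι := {a : L // basicOpen a ⊆ U}
  have : Nonempty ι := ⟨⟨⊥, by simp [basicOpen_bot]⟩⟩
  obtain ⟨⟨a, ha⟩, hUa⟩ := hc.elim_directed_cover (fun a : ι => basicOpen a.1)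
    (fun a => isOpen_basicOpen a.1)
    (fun p hp => by
      obtain ⟨_, ⟨a, rfl⟩, hpa, ha⟩ :=
        isTopologicalBasis_basicOpen.exists_subset_of_mem_open hp ho
      exact Set.mem_iUnion.2 ⟨⟨a, ha⟩, hpa⟩)
    (fun a b => ⟨⟨a.1 ⊔ b.1, by rw [basicOpen_sup]; exact Set.union_subset a.2 b.2⟩,
      basicOpen_mono le_sup_left, basicOpen_mono le_sup_right⟩)
  exact ⟨a, ha.antisymm hUa⟩

variable (L) in
/-- A bounded distributive lattice is isomorphic to the lattice of compact open subsets of its space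
of prime filters. -/
noncomputable def orderIsoCompactOpens : L ≃o CompactOpens (PrimeFilter L) :=
  RelIso.ofSurjective (OrderEmbedding.ofMapLEIff
    (fun a => (⟨⟨basicOpen a, isCompact_basicOpen a⟩, isOpen_basicOpen a⟩ :
      CompactOpens (PrimeFilter L)))
    fun _ _ => basicOpen_subset_iff) fun U => by
      obtain ⟨a, ha⟩ := exists_eq_basicOpen U.isOpen U.isCompact
      exact ⟨a, CompactOpens.ext ha⟩

end PrimeFilter

/-! ### Distributors and maps from lattice morphisms -/

section Morphisms

variable {X Y : Type u} [TopologicalSpace X] [TopologicalSpace Y]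

theorem exists_compactOpens_subset [PrespectralSpace X] {U : Set X} (hU : IsOpen U) {x : X}
    (hx : x ∈ U) : ∃ B : CompactOpens X, x ∈ B ∧ (B : Set X) ⊆ U := by
  obtain ⟨B, ⟨ho, hc⟩, hxB, hBU⟩ :=
    PrespectralSpace.isTopologicalBasis.exists_subset_of_mem_open hx hU
  exact ⟨⟨⟨B, hc⟩, ho⟩, hxB, hBU⟩

theorem specializes_iff_forall_compactOpens [PrespectralSpace X] {x y : X} :
    x ⤳ y ↔ ∀ B : CompactOpens X, y ∈ B → x ∈ B := by
  refine ⟨fun h B hy => h.mem_open B.isOpen hy, fun h => specializes_iff_forall_open.2 ?_⟩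
  intro U hU hy
  obtain ⟨B, hyB, hBU⟩ := exists_compactOpens_subset hU hy
  exact hBU (h B hyB)

theorem eq_of_forall_mem_compactOpens_iff [PrespectralSpace X] [T0Space X] {x y : X}
    (h : ∀ B : CompactOpens X, x ∈ B ↔ y ∈ B) : x = y :=
  ((specializes_iff_forall_compactOpens.2 fun B => (h B).2).antisymm
    (specializes_iff_forall_compactOpens.2 fun B => (h B).1)).eq

/-- A relation with closed values is determined by the preimages of the compact open subsets. -/
theorem rel_iff_forall_compactOpens {Z : Type u} [PrespectralSpace Y] {r : Z → Y → Prop}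
    {x : Z} (hr : IsClosed {y | r x y}) {y : Y} :
    r x y ↔ ∀ B : CompactOpens Y, y ∈ B → x ∈ relPreimage r B := by
  refine ⟨fun h B hy => ⟨y, hy, h⟩, fun h => ?_⟩
  by_contra hy
  obtain ⟨B, hyB, hB⟩ := exists_compactOpens_subset hr.isOpen_compl hy
  obtain ⟨z, hz, hxz⟩ := h B hyB
  exact hB hz hxz

/-- The form in which compactness is used: a compact set covered by a family of compact open subsets
that is closed under finite suprema lies in a member of the family. -/
theorem exists_compactOpens_superset {P : Set (CompactOpens X)} (hbot : ⊥ ∈ P)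
    (hsup : ∀ A ∈ P, ∀ B ∈ P, A ⊔ B ∈ P) {K : Set X} (hK : IsCompact K)
    (hcov : ∀ x ∈ K, ∃ B ∈ P, x ∈ B) : ∃ B ∈ P, K ⊆ B := by
  have : Nonempty P := ⟨⟨⊥, hbot⟩⟩
  obtain ⟨⟨B, hB⟩, hKB⟩ := hK.elim_directed_cover (fun B : P => (B.1 : Set X))
    (fun B => B.1.isOpen)
    (fun x hx => by
      obtain ⟨B, hB, hxB⟩ := hcov x hx
      exact Set.mem_iUnion.2 ⟨⟨B, hB⟩, hxB⟩)
    (fun A B => ⟨⟨A.1 ⊔ B.1, hsup _ A.2 _ B.2⟩, Set.subset_union_left, Set.subset_union_right⟩)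
  exact ⟨B, hB, hKB⟩

/-- The relation from `X` to `Y` induced by a map from the compact open subsets of `Y` to those of
`X`. It is the largest relation whose preimages are bounded by `h`. -/
def relOfHom (h : CompactOpens Y → CompactOpens X) (x : X) (y : Y) : Prop :=
  ∀ B : CompactOpens Y, y ∈ B → x ∈ h B

theorem isClosed_relOfHom (h : CompactOpens Y → CompactOpens X) (x : X) :
    IsClosed {y | relOfHom h x y} := by
  have : {y | relOfHom h x y}
      = ⋂ (B : CompactOpens Y) (_ : x ∉ h B), (B : Set Y)ᶜ := by
    ext y
    simp only [relOfHom, Set.mem_ofPred_eq, Set.mem_iInter, Set.mem_compl_iff, SetLike.mem_coe]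
    exact forall_congr' fun B => not_imp_not.symm
  rw [this]
  exact isClosed_biInter fun B _ => B.isOpen.isClosed_compl

theorem relPreimage_relOfHom (h : SupBotHom (CompactOpens Y) (CompactOpens X))
    (B : CompactOpens Y) : relPreimage (relOfHom h) B = h B := by
  ext x
  refine ⟨fun ⟨y, hy, hxy⟩ => hxy B hy, fun hx => ?_⟩
  by_contra hcon
  -- otherwise the `C` with `x ∉ h C` cover `B`, so that one of them contains `B`
  obtain ⟨C, hC, hBC⟩ := exists_compactOpens_superset (P := {C | x ∉ h C}) (K := (B : Set Y))
    (by rw [Set.mem_ofPred_eq, map_bot]; exact id)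
    (fun C hC D hD => by rw [Set.mem_ofPred_eq, map_sup]; exact fun h => h.elim hC hD)
    B.isCompact
    (fun y hy => by
      by_contra! hy'
      exact hcon ⟨y, hy, fun C hyC => by
        by_contra hxC
        exact hy' C hxC hyC⟩)
  exact hC ((OrderHomClass.mono h (show B ≤ C from hBC) : h B ≤ h C) hx)

theorem isSpectralDist_relOfHom [SpectralSpace X] [PrespectralSpace Y]
    (h : SupBotHom (CompactOpens Y) (CompactOpens X)) : IsSpectralDist (relOfHom h) := by
  refine isSpectralDist_iff.2 ⟨isClosed_relOfHom h, fun B ho hc => ?_⟩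
  have hB : relPreimage (relOfHom h) B = _ := relPreimage_relOfHom h ⟨⟨B, hc⟩, ho⟩
  rw [hB]
  exact ⟨CompactOpens.isOpen _, CompactOpens.isCompact _⟩

/-- A lattice homomorphism between lattices of compact open subsets is the preimage map of a
spectral map. The image of `x` is the generic point of `{y | relOfHom h x y}`, which is irreducible
because `h` preserves finite infima. -/
theorem exists_spectralMap_preimage_eq [SpectralSpace X] [SpectralSpace Y]
    (h : BoundedLatticeHom (CompactOpens Y) (CompactOpens X)) :
    ∃ f : SpectralMap X Y, ∀ B : CompactOpens Y, f ⁻¹' (B : Set Y) = h B := by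
  have hmem : ∀ (x : X) (B : CompactOpens Y),
      ({y | relOfHom h x y} ∩ (B : Set Y)).Nonempty ↔ x ∈ h B := by
    intro x B
    have := Set.ext_iff.1 (relPreimage_relOfHom (h : SupBotHom _ _) B) x
    exact Iff.trans ⟨fun ⟨y, hy, hB⟩ => ⟨y, hB, hy⟩, fun ⟨y, hB, hy⟩ => ⟨y, hy, hB⟩⟩ this
  have hirr : ∀ x, IsIrreducible {y | relOfHom h x y} := by
    refine fun x => ⟨?_, fun U V hU hV => ?_⟩
    · refine ((hmem x ⊤).2 ?_).left
      rw [map_top]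
      trivial
    · rintro ⟨y, hy, hyU⟩ ⟨z, hz, hzV⟩
      obtain ⟨B, hyB, hBU⟩ := exists_compactOpens_subset hU hyU
      obtain ⟨C, hzC, hCV⟩ := exists_compactOpens_subset hV hzV
      refine ((hmem x (B ⊓ C)).2 ?_).mono
        (Set.inter_subset_inter_right _ (Set.inter_subset_inter hBU hCV))
      rw [map_inf]
      exact ⟨hy B hyB, hz C hzC⟩
  choose f hf using fun x => QuasiSober.sober (hirr x) (isClosed_relOfHom h x)
  have hpre : ∀ B : CompactOpens Y, f ⁻¹' (B : Set Y) = h B := fun B =>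
    Set.ext fun x => ((hf x).mem_open_set_iff B.isOpen).trans (hmem x B)
  refine ⟨⟨f, ⟨PrespectralSpace.isTopologicalBasis.continuous_iff.2 ?_, ?_⟩⟩, hpre⟩
  · rintro B ⟨ho, hc⟩
    have hB : f ⁻¹' B = _ := hpre ⟨⟨B, hc⟩, ho⟩
    rw [hB]
    exact CompactOpens.isOpen _
  · intro B ho hc
    have hB : f ⁻¹' B = _ := hpre ⟨⟨B, hc⟩, ho⟩
    rw [hB]
    exact CompactOpens.isCompact _

end Morphisms

/-! ### Esakia spaces and co-Heyting algebras -/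

section Esakia

variable {X Y : Type u} [TopologicalSpace X] [TopologicalSpace Y]

/-- The differences of compact open subsets form a base of the patch topology. -/
theorem exists_diff_subset_of_isOpen_patch [SpectralSpace X] {A : Set X}
    (hA : IsOpen[constructibleTopology X] A) {a : X} (ha : a ∈ A) :
    ∃ B C : CompactOpens X, a ∈ (B : Set X) \ C ∧ (B : Set X) \ C ⊆ A := by
  induction hA with
  | basic s hs =>
    rcases hs with ⟨ho, hc⟩ | ⟨hcl, hc⟩
    · exact ⟨⟨⟨s, hc⟩, ho⟩, ⊥, ⟨ha, id⟩, Set.sdiff_subset⟩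
    · refine ⟨⊤, ⟨⟨sᶜ, hc⟩, hcl.isOpen_compl⟩, ⟨trivial, fun h => h ha⟩, ?_⟩
      exact fun x hx => not_not.1 hx.2
  | univ => exact ⟨⊤, ⊥, ⟨trivial, id⟩, Set.subset_univ _⟩
  | inter s t _ _ hs ht =>
    obtain ⟨B, C, ⟨haB, haC⟩, h⟩ := hs ha.1
    obtain ⟨B', C', ⟨haB', haC'⟩, h'⟩ := ht ha.2
    refine ⟨B ⊓ B', C ⊔ C', ⟨⟨haB, haB'⟩, fun h => h.elim haC haC'⟩, ?_⟩
    exact fun x hx => ⟨h ⟨hx.1.1, fun hC => hx.2 (Or.inl hC)⟩,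
      h' ⟨hx.1.2, fun hC => hx.2 (Or.inr hC)⟩⟩
  | sUnion S _ ih =>
    obtain ⟨s, hs, has⟩ := ha
    obtain ⟨B, C, h, hsub⟩ := ih s hs has
    exact ⟨B, C, h, hsub.trans (Set.subset_sUnion_of_mem hs)⟩

theorem isClopen_ofPatch_diff (A B : CompactOpens X) :
    IsClopen (ofPatch ⁻¹' ((A : Set X) \ B)) :=
  (isClopen_ofPatch A.isOpen A.isCompact).diff (isClopen_ofPatch B.isOpen B.isCompact)

/-- In the lattice of compact open subsets, a co-Heyting difference of `A` and `B` is the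
down-closure of the set-theoretic difference. -/
theorem coe_eq_downClosure_of_sdiff_adjoint [SpectralSpace X] {A B C : CompactOpens X}
    (h : ∀ D, C ≤ D ↔ A ≤ B ⊔ D) : (C : Set X) = downClosure ((A : Set X) \ B) := by
  apply subset_antisymm
  · intro x hx
    by_contra hcon
    -- if `x` is not below any point of `A \ B`, then `A \ B` has a compact open neighbourhood
    -- avoiding `x`, which contradicts the minimality of `C`
    obtain ⟨D, hD, hsub⟩ := exists_compactOpens_superset (P := {D : CompactOpens X | x ∉ D})
      id (fun D hD E hE h => h.elim hD hE) (isCompact_of_patch (isClopen_ofPatch_diff A B).1)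
      (fun a ha => by
        by_contra! ha'
        exact hcon ⟨a, ha, specializes_iff_forall_compactOpens.2 fun D haD => by
          by_contra hxD
          exact ha' D hxD haD⟩)
    refine hD ((h D).2 (fun y hy => ?_) hx)
    by_cases hyB : y ∈ B
    · exact Or.inl hyB
    · exact Or.inr (hsub ⟨hy, hyB⟩)
  · rintro x ⟨a, ⟨haA, haB⟩, hxa⟩
    exact hxa.mem_open C.isOpen (((h C).1 le_rfl haA).resolve_left haB)

theorem isEsakia_of_isCoHeyting [SpectralSpace X] (hX : IsCoHeyting (CompactOpens X)) :
    IsEsakia X := by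
  intro A hA
  refine isOpen_iff_forall_mem_open.2 ?_
  rintro x ⟨a, ha, hxa⟩
  obtain ⟨B, C, haBC, hsub⟩ := exists_diff_subset_of_isOpen_patch hA ha
  obtain ⟨D, hD⟩ := hX B C
  have hD' := coe_eq_downClosure_of_sdiff_adjoint hD
  refine ⟨D, ?_, D.isOpen, ?_⟩
  · rw [hD']
    rintro y ⟨b, hb, hyb⟩
    exact ⟨b, hsub hb, hyb⟩
  · rw [hD']
    exact ⟨a, haBC, hxa⟩

theorem isCoHeyting_compactOpens_iff [SpectralSpace X] :
    IsCoHeyting (CompactOpens X) ↔ IsEsakia X :=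
  ⟨isEsakia_of_isCoHeyting, isCoHeyting_compactOpens⟩

theorem IsCoHeyting.of_orderIso {α β : Type u} [Lattice α] [Lattice β] (h : IsCoHeyting α)
    (e : α ≃o β) : IsCoHeyting β := by
  intro a b
  obtain ⟨c, hc⟩ := h (e.symm a) (e.symm b)
  refine ⟨e c, fun d => ?_⟩
  rw [← e.le_symm_apply, hc, ← e.le_iff_le, map_sup]
  simp

/-- The back condition for `g` amounts to the commutation of preimages along `g` with down-closures
of differences of compact open subsets. -/
theorem preimage_downClosure_diff_iff [SpectralSpace X] [SpectralSpace Y] {g : X → Y}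
    (hg : IsSpectralMap g) :
    (∀ A B : CompactOpens Y, g ⁻¹' downClosure ((A : Set Y) \ B)
        = downClosure (g ⁻¹' A \ g ⁻¹' B)) ↔
      ∀ (x : X) (y : Y), g x ⤳ y → ∃ x', x ⤳ x' ∧ g x' = y := by
  constructor
  · intro h x y hxy
    let I := {p : CompactOpens Y × CompactOpens Y // y ∈ p.1 ∧ y ∉ p.2}
    let t : I → Set (WithConstructibleTopology X) := fun p =>
      ofPatch ⁻¹' ({x' | x ⤳ x'} ∩ g ⁻¹' ((p.1.1 : Set Y) \ p.1.2))
    have hcl : ∀ p, IsClosed (t p) := fun p =>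
      ((isClosed_specializes x).preimage continuous_ofPatch).inter
        ((isClopen_ofPatch_diff p.1.1 p.1.2).1.preimage (isSpectralMap_patchFun hg).continuous)
    have : Nonempty I := ⟨⟨(⊤, ⊥), trivial, id⟩⟩
    have hdir : Directed (· ⊇ ·) t := by
      rintro ⟨⟨A, B⟩, hA, hB⟩ ⟨⟨A', B'⟩, hA', hB'⟩
      refine ⟨⟨(A ⊓ A', B ⊔ B'), ⟨hA, hA'⟩, fun h => h.elim hB hB'⟩, ?_, ?_⟩
      · exact fun z hz => ⟨hz.1, hz.2.1.1, fun h => hz.2.2 (Or.inl h)⟩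
      · exact fun z hz => ⟨hz.1, hz.2.1.2, fun h => hz.2.2 (Or.inr h)⟩
    have hne : ∀ p, (t p).Nonempty := by
      rintro ⟨⟨A, B⟩, hA, hB⟩
      obtain ⟨x', hx', hxx'⟩ :=
        (h A B).subset (show x ∈ g ⁻¹' downClosure ((A : Set Y) \ B) from ⟨y, ⟨hA, hB⟩, hxy⟩)
      exact ⟨toPatch x', hxx', hx'⟩
    obtain ⟨z, hz⟩ := IsCompact.nonempty_iInter_of_directed_nonempty_isCompact_isClosed t hdir hne
      (fun p => (hcl p).isCompact) hcl
    rw [Set.mem_iInter] at hz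
    refine ⟨ofPatch z, (hz (Classical.arbitrary I)).1,
      eq_of_forall_mem_compactOpens_iff fun B => ⟨fun hB => ?_, fun hB => ?_⟩⟩
    · by_contra hy
      exact (hz ⟨(⊤, B), trivial, hy⟩).2.2 hB
    · exact (hz ⟨(B, ⊥), hB, id⟩).2.1
  · intro h A B
    ext x
    constructor
    · rintro ⟨y, hy, hxy⟩
      obtain ⟨x', hx, rfl⟩ := h x y hxy
      exact ⟨x', hy, hx⟩
    · rintro ⟨x', hx', hx⟩
      exact ⟨g x', hx', hx.map hg.continuous⟩

end Esakia

/-! ### The dualities -/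

section Dualities

/-- An order isomorphism, as an isomorphism of `DLat_{⊥,∨}`. -/
def DLatSup.isoOfOrderIso {L M : DLatSup.{u}} (e : L.toDLat ≃o M.toDLat) : L ≅ M where
  hom := ⟨(e : SupBotHom L.toDLat M.toDLat)⟩
  inv := ⟨(e.symm : SupBotHom M.toDLat L.toDLat)⟩
  hom_inv_id := DLatSup.Hom.ext <| SupBotHom.ext e.symm_apply_apply
  inv_hom_id := DLatSup.Hom.ext <| SupBotHom.ext e.apply_symm_apply

/-- An order isomorphism, as an isomorphism of `DLat`. -/
def bddDistLatIsoOfOrderIso {L M : BddDistLat.{u}} (e : L ≃o M) : L ≅ M where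
  hom := BddDistLat.ofHom (e : BoundedLatticeHom L M)
  inv := BddDistLat.ofHom (e.symm : BoundedLatticeHom M L)
  hom_inv_id := BddDistLat.ext e.symm_apply_apply
  inv_hom_id := BddDistLat.ext e.apply_symm_apply

instance : compactOpensDist.{u}.Faithful where
  map_injective {X Y} r s h := by
    apply Quiver.Hom.unop_inj
    apply SpecDist.Hom.ext
    funext x y
    rw [eq_iff_iff, rel_iff_forall_compactOpens ((isSpectralDist_iff.1 r.unop.isSpectralDist).1 x),
      rel_iff_forall_compactOpens ((isSpectralDist_iff.1 s.unop.isSpectralDist).1 x)]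
    refine forall_congr' fun B => ?_
    have hB : relPreimage r.unop.rel B = relPreimage s.unop.rel B :=
      congrArg (fun C : CompactOpens Y.unop.carrier => (C : Set Y.unop.carrier))
        (DFunLike.congr_fun (congrArg DLatSup.Hom.hom h) B)
    rw [hB]

instance : compactOpensDist.{u}.Full where
  map_surjective {X Y} h := by
    let k : SupBotHom (CompactOpens X.unop.carrier) (CompactOpens Y.unop.carrier) := h.hom
    let r : Y.unop ⟶ X.unop := ⟨relOfHom k, isSpectralDist_relOfHom k⟩
    exact ⟨r.op, DLatSup.Hom.ext <| SupBotHom.ext fun B =>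
      CompactOpens.ext (relPreimage_relOfHom k B)⟩

instance : compactOpensDist.{u}.EssSurj where
  mem_essImage L := ⟨op ⟨PrimeFilter L.toDLat⟩,
    ⟨(DLatSup.isoOfOrderIso (PrimeFilter.orderIsoCompactOpens L.toDLat)).symm⟩⟩

instance : compactOpensDist.{u}.IsEquivalence where

theorem isEsakia_primeFilter {L : Type u} [DistribLattice L] [BoundedOrder L]
    (hL : IsCoHeyting L) : IsEsakia (PrimeFilter L) :=
  isEsakia_of_isCoHeyting (hL.of_orderIso (PrimeFilter.orderIsoCompactOpens L))

instance : compactOpensEsaDist.{u}.Faithful :=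
  have : (compactOpensEsaDist.{u} ⋙ ObjectProperty.ι _).Faithful :=
    inferInstanceAs ((ObjectProperty.ι fun X : SpecDist.{u} => IsEsakia X.carrier).op ⋙
      compactOpensDist.{u}).Faithful
  .of_comp _ (ObjectProperty.ι _)

instance : compactOpensEsaDist.{u}.Full :=
  have : (compactOpensEsaDist.{u} ⋙ ObjectProperty.ι _).Full :=
    inferInstanceAs ((ObjectProperty.ι fun X : SpecDist.{u} => IsEsakia X.carrier).op ⋙
      compactOpensDist.{u}).Full
  .of_comp_faithful _ (ObjectProperty.ι _)

instance : compactOpensEsaDist.{u}.EssSurj where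
  mem_essImage L := ⟨op ⟨⟨PrimeFilter L.obj.toDLat⟩, isEsakia_primeFilter L.property⟩,
    ⟨ObjectProperty.isoMk _
      (DLatSup.isoOfOrderIso (PrimeFilter.orderIsoCompactOpens L.obj.toDLat)).symm⟩⟩

instance : compactOpensEsaDist.{u}.IsEquivalence where

theorem esaStar_op_comp_compactOpensEsaDist :
    esaStar.{u}.op ⋙ compactOpensEsaDist.{u} = compactOpensEsa.{u} ⋙ coHeytForgetInf.{u} := by
  refine CategoryTheory.Functor.hext (fun X => rfl) fun X Y f => heq_of_eq ?_
  apply ObjectProperty.hom_ext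
  apply DLatSup.Hom.ext
  apply SupBotHom.ext
  intro B
  exact CompactOpens.ext (relPreimage_star B.isOpen)

instance : compactOpensEsa.{u}.Faithful where
  map_injective {X Y} f g h := by
    apply Quiver.Hom.unop_inj
    apply ObjectProperty.hom_ext
    apply Spec.Hom.ext
    apply DFunLike.ext
    intro x
    refine eq_of_forall_mem_compactOpens_iff fun B => ?_
    have hB : f.unop.hom.map ⁻¹' B = g.unop.hom.map ⁻¹' B :=
      congrArg (fun C : CompactOpens Y.unop.obj.carrier => (C : Set Y.unop.obj.carrier))
        (ConcreteCategory.congr_hom (congrArg InducedCategory.Hom.hom h) B)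
    exact Set.ext_iff.1 hB x

instance : compactOpensEsa.{u}.Full where
  map_surjective {X Y} h := by
    let k : BoundedLatticeHom (CompactOpens X.unop.obj.carrier)
      (CompactOpens Y.unop.obj.carrier) := h.hom.hom
    obtain ⟨f, hf⟩ := exists_spectralMap_preimage_eq k
    let g : Y.unop ⟶ X.unop := ObjectProperty.homMk ⟨f⟩
    exact ⟨g.op, ObjectProperty.hom_ext _ <| BddDistLat.ext fun B => CompactOpens.ext (hf B)⟩

instance : compactOpensEsa.{u}.EssSurj where
  mem_essImage L := ⟨op ⟨⟨PrimeFilter L.obj⟩, isEsakia_primeFilter L.property⟩,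
    ⟨ObjectProperty.isoMk _
      (bddDistLatIsoOfOrderIso (PrimeFilter.orderIsoCompactOpens L.obj)).symm⟩⟩

instance : compactOpensEsa.{u}.IsEquivalence where

end Dualities

/-! ### Preservation of the co-Heyting operation -/

section Preservation

theorem preservesCoHeyting_of_isIso {L M : CoHeyt.{u}} (e : L ≅ M) : PreservesCoHeyting e.hom := by
  have hinv : ∀ x, e.inv.hom (e.hom.hom x) = x := fun x =>
    ConcreteCategory.congr_hom (congrArg InducedCategory.Hom.hom e.hom_inv_id) x
  have hinv' : ∀ x, e.hom.hom (e.inv.hom x) = x := fun x =>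
    ConcreteCategory.congr_hom (congrArg InducedCategory.Hom.hom e.inv_hom_id) x
  have hle : ∀ x y, e.hom.hom x ≤ y ↔ x ≤ e.inv.hom y := by
    refine fun x y => ⟨fun h => ?_, fun h => ?_⟩
    · simpa [hinv] using OrderHomClass.mono e.inv.hom.hom h
    · simpa [hinv'] using OrderHomClass.mono e.hom.hom.hom h
  intro a b
  refine eq_of_forall_ge_iff fun d => ?_
  rw [hle, sdiff_le_iff, sdiff_le_iff, hle, map_sup, hinv]

theorem PreservesCoHeyting.comp {L M N : CoHeyt.{u}} {f : L ⟶ M} {g : M ⟶ N}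
    (hf : PreservesCoHeyting f) (hg : PreservesCoHeyting g) : PreservesCoHeyting (f ≫ g) := by
  intro a b
  change g.hom (f.hom _) = g.hom (f.hom a) \ g.hom (f.hom b)
  rw [hf, hg]

theorem preservesCoHeyting_iff_of_iso {L L' M M' : CoHeyt.{u}} {f : L ⟶ M} {f' : L' ⟶ M'}
    (e : L ≅ L') (e' : M ≅ M') (h : f ≫ e'.hom = e.hom ≫ f') :
    PreservesCoHeyting f ↔ PreservesCoHeyting f' := by
  constructor
  · intro hf
    rw [← (Iso.inv_comp_eq e).2 h]
    exact (preservesCoHeyting_of_isIso e.symm).comp (hf.comp (preservesCoHeyting_of_isIso e'))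
  · intro hf
    rw [(Iso.eq_comp_inv e').2 h, Category.assoc]
    exact (preservesCoHeyting_of_isIso e).comp (hf.comp (preservesCoHeyting_of_isIso e'.symm))

/-- The difference in the co-Heyting algebra `compactOpensEsa.obj (op X)`, as an operation on
compact open subsets. -/
noncomputable def compactOpensSDiff (X : Esa.{u}) (A B : CompactOpens X.obj.carrier) :
    CompactOpens X.obj.carrier :=
  @SDiff.sdiff (compactOpensEsa.obj (op X)).obj _ A B

theorem coe_compactOpensSDiff {X : Esa.{u}} (A B : CompactOpens X.obj.carrier) :
    (compactOpensSDiff X A B : Set X.obj.carrier) = downClosure ((A : Set X.obj.carrier) \ B) :=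
  coe_eq_downClosure_of_sdiff_adjoint fun D =>
    sdiff_le_iff (α := (compactOpensEsa.obj (op X)).obj) (a := A) (b := B) (c := D)

theorem preservesCoHeyting_compactOpensEsa_map_iff {X Y : Esa.{u}} (g : X ⟶ Y) :
    PreservesCoHeyting (compactOpensEsa.map g.op) ↔
      ∀ (x : X.obj.carrier) (y : Y.obj.carrier), g.hom.map x ⤳ y →
        ∃ x', x ⤳ x' ∧ g.hom.map x' = y := by
  rw [← preimage_downClosure_diff_iff (SpectralMapClass.map_spectral g.hom.map)]
  refine forall₂_congr fun (A B : CompactOpens Y.obj.carrier) => ?_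
  let k : CompactOpens Y.obj.carrier → CompactOpens X.obj.carrier :=
    (compactOpensEsa.map g.op).hom
  change k (compactOpensSDiff Y A B) = compactOpensSDiff X (k A) (k B) ↔ _
  rw [← SetLike.coe_injective.eq_iff, coe_compactOpensSDiff, ← coe_compactOpensSDiff A B]
  rfl

/-- Both composites in the equation are computed pointwise. On the right the patch of `Y`
contributes no specializations besides equalities, since it is Hausdorff. -/
theorem lowerStar_map_comp_iUpperStar_eq_iff {X Y : Esa.{u}} (g : X ⟶ Y) :
    lowerStar.map g.hom ≫ iUpperStar Y = iUpperStar X ≫ lowerStar.map (Spec.patchMap g.hom) ↔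
      ∀ (x : X.obj.carrier) (y : Y.obj.carrier), g.hom.map x ⤳ y →
        ∃ x', x ⤳ x' ∧ g.hom.map x' = y := by
  have hl : ∀ x z, (lowerStar.map g.hom ≫ iUpperStar Y).rel x z ↔ g.hom.map x ⤳ ofPatch z :=
    fun x z => ⟨fun ⟨_, h, h'⟩ => h.trans h', fun h => ⟨_, specializes_rfl, h⟩⟩
  have hr : ∀ x z, (iUpperStar X ≫ lowerStar.map (Spec.patchMap g.hom)).rel x z ↔
      ∃ x', x ⤳ x' ∧ g.hom.map x' = ofPatch z := by
    refine fun x z => ⟨fun ⟨w, h, h'⟩ => ⟨ofPatch w, h, congrArg ofPatch ?_⟩, ?_⟩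
    · exact (specializes_iff_eq (X := WithConstructibleTopology Y.obj.carrier)).1 h'
    · rintro ⟨x', h, h'⟩
      exact ⟨toPatch x', h, specializes_of_eq (congrArg toPatch h')⟩
  constructor
  · intro h x y hxy
    exact (hr x (toPatch y)).1 (h ▸ (hl x (toPatch y)).2 hxy)
  · intro h
    apply SpecDist.Hom.ext
    funext x z
    rw [eq_iff_iff, hl, hr]
    refine ⟨h x (ofPatch z), ?_⟩
    rintro ⟨x', hx, hz⟩
    exact hz ▸ hx.map g.hom.map.spectral'.continuous

end Preservation

end EsakiaDuality

/-- Esakia duality for spectral distributors, and its restriction to maps. -/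
theorem mainTheorem1 :
    -- the duality between `SpecDist` and `DLat_{⊥,∨}`
    (compactOpensDist.{u}.rightOp : SpecDist.{u} ⥤ DLatSup.{u}ᵒᵖ).IsEquivalence ∧
    -- it restricts to a duality between `EsaDist` and `coHeyt_{⊥,∨}`
    (compactOpensEsaDist.{u}.rightOp : EsaDist.{u} ⥤ CoHeytSup.{u}ᵒᵖ).IsEquivalence ∧
    (∀ X : SpecDist.{u}, IsCoHeyting (CompactOpens X.carrier) ↔ IsEsakia X.carrier) ∧
    -- which, restricted to maps and lattice homomorphisms, is a duality between `Esa` and `coHeyt`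
    (esaStar.{u}.op ⋙ compactOpensEsaDist.{u} = compactOpensEsa.{u} ⋙ coHeytForgetInf.{u}) ∧
    (compactOpensEsa.{u}.rightOp : Esa.{u} ⥤ CoHeyt.{u}ᵒᵖ).IsEquivalence ∧
    -- preservation of the co-Heyting operation, for `f : L₂ ⟶ L₁` corresponding to `g : X₁ ⟶ X₂`
    (∀ (L₁ L₂ : CoHeyt.{u}) (f : L₂ ⟶ L₁) (X₁ X₂ : Esa.{u}) (g : X₁ ⟶ X₂)
      (e₁ : L₁ ≅ compactOpensEsa.obj (op X₁)) (e₂ : L₂ ≅ compactOpensEsa.obj (op X₂)),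
      f ≫ e₁.hom = e₂.hom ≫ compactOpensEsa.map g.op →
      (PreservesCoHeyting f ↔
        lowerStar.map g.hom ≫ iUpperStar X₂ = iUpperStar X₁ ≫ lowerStar.map (Spec.patchMap g.hom)) ∧
      (lowerStar.map g.hom ≫ iUpperStar X₂ = iUpperStar X₁ ≫ lowerStar.map (Spec.patchMap g.hom) ↔
        ∀ (x : X₁.obj.carrier) (y : X₂.obj.carrier), g.hom.map x ⤳ y →
          ∃ x' : X₁.obj.carrier, x ⤳ x' ∧ g.hom.map x' = y)) := by
  refine ⟨inferInstance, inferInstance, fun X => isCoHeyting_compactOpens_iff,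
    esaStar_op_comp_compactOpensEsaDist, inferInstance, ?_⟩
  intro L₁ L₂ f X₁ X₂ g e₁ e₂ h
  refine ⟨?_, lowerStar_map_comp_iUpperStar_eq_iff g⟩
  rw [preservesCoHeyting_iff_of_iso e₂ e₁ h, preservesCoHeyting_compactOpensEsa_map_iff,
    lowerStar_map_comp_iUpperStar_eq_iff]
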